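/- **Setting.** Let $\Delta\ge 1$ be an integer, $K=\mathbb Q(\sqrt{-\Delta})$, and let $p\ne 2$ be a prime that is inert in $K$, i.e. $\left(\frac{-\Delta}{p}\right)=-1$, so that $\mathbb F_{p^2}=\mathbb F_p(\sqrt{-\Delta})$; for $x=a+b\sqrt{-\Delta}$ put $\bar x=a-b\sqrt{-\Delta}$ and $\operatorname{im}x=b$. Let $N\ge 1$ be an integer prime to $p$, and $g=i+j$ with $i,j\ge1$. All $g\times g$ matrices are divided into blocks of sizes $i,j$, and $E=\begin{pmatrix}1_i&0\\0&-1_j\end{pmatrix}$. *The groups.* $GSp_{2g}$ is the group of symplectic similitudes of $\begin{pmatrix}0&-1_g\\1_g&0\end{pmatrix}$, and $\mathcal K\subset GSp_{2g}(\mathbb A_f)$ is the subgroup of the elements of $GSp_{2g}(\hat{\mathbb Z})$ congruent to $1$ modulo $N$. $G_V=GU(i,j)$ is the group of the matrices $\mathfrak g=h+k\sqrt{-\Delta}$ with $\mathfrak gE\bar{\mathfrak g}^t=\lambda E$, where $\lambda$ is an invertible scalar (of $R$, for the $R$-points); it is embedded in $GSp_{2g}$ by $$\alpha(\mathfrak g)=\begin{pmatrix}h&kE\\-\Delta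 Ek&EhE\end{pmatrix},$$ and $\mathcal K_V=\mathcal K\cap\alpha(G_V(\mathbb A_f))$. *The set $S(g,i)^{open}$.* Fix a system of representatives of $\mathbb Z$ modulo $p$ and one modulo $p^2$. $S(g,i)^{open}$ is the set of the matrices (diagonal blocks of sizes $i,j,i,j$) $$\sigma=\begin{pmatrix}p&0&0&pC^t\\-A&1&C&U\\0&0&p&pA^t\\0&0&0&p^2\end{pmatrix},$$ where $A,C$ are integral $j\times i$ matrices with entries in the first system, $U$ is an integral $j\times j$ matrix whose diagonal and upper-triangular entries are in the second system, and $CA^t-AC^t=U-U^t$. *D-equivalence.* $\sigma_1,\sigma_2\in S(g,i)^{open}$ are D-equivalent iff the double cosets $\mathcal K\sigma_1\mathcal K_V$ and $\mathcal K\sigma_2\mathcal K_V$ coincide. (For $N=1$ this means that $\sigma_1\alpha(\mathfrak g)\sigma_2^{-1}$ has entries in $\mathbb Z_p$ for some $\mathfrak g\in G_V(\mathbb Z_p)$.) The classes of this relation form the D-partition. *The $\mathfrak D$-partition.* Put $$\mu_1=\begin{pmatrix}-1&-C^t\sqrt{-\Delta}\\A+C\sqrt{-\Delta}&-1-U\sqrt{-\Delta}\end{pmatrix},\qquad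 \mu_2=\begin{pmatrix}\sqrt{-\Delta}&-A^t\sqrt{-\Delta}\\A+C\sqrt{-\Delta}&-1-U\sqrt{-\Delta}\end{pmatrix},$$ and let $\tilde\mu_1,\tilde\mu_2\in M_g(\mathbb F_{p^2})$ be their reductions modulo $p$. Then $\sigma\in\mathfrak D_*$ iff $\det\tilde\mu_1=\det\tilde\mu_2=0$. If $\det\tilde\mu_1\ne0$, write $\tilde\mu_2=\begin{pmatrix}X_1&X_2\\0&1\end{pmatrix}\tilde\mu_1$; then $\sigma\in\mathfrak D_k$ iff $\operatorname{rank}\operatorname{im}X_1=k$ $(0\le k\le i)$. If $\det\tilde\mu_1=0\ne\det\tilde\mu_2$, then $\mathfrak D_k$ is defined in the same way with $\mu_1$ and $\mu_2$ interchanged. The $\mathfrak D$-partition has the parts $\mathfrak D_*,\mathfrak D_0,\dots,\mathfrak D_i$. **Theorem.** Let $g=3$. 1. If $i=1$, $\sigma_1\in\mathfrak D_0$ and $\sigma_2\in\mathfrak D_1$, then $\sigma_1$ and $\sigma_2$ are not D-equivalent. 2. If $i=2$, $\sigma_1\in\mathfrak D_1$ and $\sigma_2\in\mathfrak D_2$,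 then $\sigma_1$ and $\sigma_2$ are not D-equivalent. 3. If $i=1$, $\sigma_1\in\mathfrak D_0\cup\mathfrak D_1$ and $\sigma_2\in\mathfrak D_*$, then $\sigma_1$ and $\sigma_2$ are not D-equivalent. 4. If $i=1$, the D-partition of $S(3,1)^{open}$ is a refinement of its $\mathfrak D$-partition: every D-equivalence class is contained in exactly one of $\mathfrak D_*$, $\mathfrak D_0$, $\mathfrak D_1$. -/

import Mathlib

/-!
Notation: `g = i + j`, the index set of `g × g` matrices is `Fin i ⊕ Fin j` and that of
`2g × 2g` matrices is `(Fin i ⊕ Fin j) ⊕ (Fin i ⊕ Fin j)`.  For a commutative ring `R`,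
`R[√-Δ]` is `QuadraticAlgebra R (-Δ) 0`; its element `⟨x, y⟩` is `x + y √-Δ`, `re` and `im` are
the real and the imaginary part, and `star` is the conjugation `√-Δ ↦ -√-Δ`.
-/

namespace HeckeUnitary

open Matrix

/-- The ring `R[√-Δ]` (equal to `R ⊗ ℤ[√-Δ]`). -/
abbrev Quad (R : Type*) [CommRing R] (Δ : ℕ) : Type _ := QuadraticAlgebra R (-(Δ : R)) 0

/-- The indices of `g × g` matrices, divided into blocks of sizes `i` and `j = g - i`. -/
abbrev Ix (i j : ℕ) : Type := Fin i ⊕ Fin j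

/-- The indices of `2g × 2g` matrices (diagonal blocks of sizes `i, j, i, j`). -/
abbrev Ix2 (i j : ℕ) : Type := Ix i j ⊕ Ix i j

/-- The signature matrix `E = diag(1, …, 1, -1, …, -1)`, with `i` ones and `j` minus ones. -/
def sgnE (R : Type*) [CommRing R] (i j : ℕ) : Matrix (Ix i j) (Ix i j) R :=
  fromBlocks 1 0 0 (-1)

/-- The `R`-points of the group `GSp_{2g}` of symplectic similitudes.  (The equation, with `c` a
unit, forces the matrix to be invertible.) -/
def GSp (R : Type*) [CommRing R] (i j : ℕ) : Set (Matrix (Ix2 i j) (Ix2 i j) R) :=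
  {m | ∃ c : Rˣ, m * J (Ix i j) R * mᵀ = (c : R) • J (Ix i j) R}

/-- The `R`-points of the unitary similitude group `G_V = GU(i, j)`: the matrices
`𝔤 = h + k √-Δ` with `𝔤 E (conjugate transpose of 𝔤) = c E` for a unit `c` of `R`. -/
def GU (R : Type*) [CommRing R] (Δ i j : ℕ) : Set (Matrix (Ix i j) (Ix i j) (Quad R Δ)) :=
  {m | ∃ c : Rˣ, m * sgnE (Quad R Δ) i j * mᴴ = (c : R) • sgnE (Quad R Δ) i j}

/-- The inclusion `α : G_V → GSp_{2g}`,
`h + k √-Δ ↦ (h, k E; -Δ E k, E h E)`. -/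
def alphaMap (R : Type*) [CommRing R] (Δ i j : ℕ) (m : Matrix (Ix i j) (Ix i j) (Quad R Δ)) :
    Matrix (Ix2 i j) (Ix2 i j) R :=
  fromBlocks (m.map QuadraticAlgebra.re) (m.map QuadraticAlgebra.im * sgnE R i j)
    (-(Δ : R) • (sgnE R i j * m.map QuadraticAlgebra.im))
    (sgnE R i j * m.map QuadraticAlgebra.re * sgnE R i j)

/-- The ring `𝔸_f` of finite adeles of `ℚ`. -/
abbrev Af : Type := IsDedekindDomain.FiniteAdeleRing ℤ ℚ

/-- The subring of `𝔸_f` of the adeles that are integral at every prime (the profinite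
completion of `ℤ`). -/
def zHat : Subring Af where
  carrier := {a | ∀ v, a v ∈ v.adicCompletionIntegers ℚ}
  mul_mem' ha hb v := mul_mem (ha v) (hb v)
  one_mem' v := one_mem (v.adicCompletionIntegers ℚ)
  add_mem' ha hb v := add_mem (ha v) (hb v)
  zero_mem' v := zero_mem (v.adicCompletionIntegers ℚ)
  neg_mem' ha v := neg_mem (ha v)

/-- The level subgroup `𝒦 = 𝒦_N` of `GSp_{2g}(𝔸_f)`: the symplectic similitudes over the integral
adeles that are congruent to the unit matrix modulo `N`. -/
noncomputable def levelK (N i j : ℕ) : Set (Matrix (Ix2 i j) (Ix2 i j) Af) :=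
  (fun m : Matrix (Ix2 i j) (Ix2 i j) zHat => m.map zHat.subtype) ''
    {m | m ∈ GSp zHat i j ∧ ∃ x : Matrix (Ix2 i j) (Ix2 i j) zHat, m = 1 + (N : zHat) • x}

/-- The level subgroup `𝒦_V = 𝒦 ∩ α(G_V(𝔸_f))`. -/
noncomputable def levelKV (Δ N i j : ℕ) : Set (Matrix (Ix2 i j) (Ix2 i j) Af) :=
  levelK N i j ∩ alphaMap Af Δ i j '' GU Af Δ i j

/-- `R` is a system of representatives of `ℤ` modulo `n`. -/
def IsResidueSystem (n : ℕ) (R : Set ℤ) : Prop :=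
  Set.BijOn (fun x : ℤ => (x : ZMod n)) R Set.univ

/-- The parameters `A`, `C`, `U` of an element of `S(g, i)^open`, for given systems `R₁`, `R₂` of
representatives of `ℤ` modulo `p` and modulo `p ^ 2`; the element itself is `SOpen.toMatrix`. -/
@[ext]
structure SOpen (i j : ℕ) (R₁ R₂ : Set ℤ) where
  A : Matrix (Fin j) (Fin i) ℤ
  C : Matrix (Fin j) (Fin i) ℤ
  U : Matrix (Fin j) (Fin j) ℤ
  A_mem : ∀ a b, A a b ∈ R₁
  C_mem : ∀ a b, C a b ∈ R₁
  U_mem : ∀ a b, a ≤ b → U a b ∈ R₂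
  rel : C * Aᵀ - A * Cᵀ = U - Uᵀ

namespace SOpen

variable {i j : ℕ} {R₁ R₂ : Set ℤ}

/-- The element `σ` of `S(g, i)^open` with parameters `A`, `C`, `U`:
`σ = (p, 0, 0, p Cᵗ; -A, 1, C, U; 0, 0, p, p Aᵗ; 0, 0, 0, p ^ 2)`. -/
def toMatrix (p : ℕ) (s : SOpen i j R₁ R₂) : Matrix (Ix2 i j) (Ix2 i j) ℤ :=
  fromBlocks
    (fromBlocks ((p : ℤ) • 1) 0 (-s.A) 1) (fromBlocks 0 ((p : ℤ) • s.Cᵀ) s.C s.U)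
    0 (fromBlocks ((p : ℤ) • 1) ((p : ℤ) • s.Aᵀ) 0 (((p : ℤ) ^ 2) • 1))

/-- The image of `σ` in the matrices over the finite adeles. -/
noncomputable def toAdelic (p : ℕ) (s : SOpen i j R₁ R₂) : Matrix (Ix2 i j) (Ix2 i j) Af :=
  (s.toMatrix p).map (Int.cast : ℤ → Af)

/-- The setoid of D-equivalence on `S(g, i)^open`: `σ₁` and `σ₂` are D-equivalent iff the double
cosets `𝒦 σ₁ 𝒦_V` and `𝒦 σ₂ 𝒦_V` coincide. -/
def dSetoid (p Δ N i j : ℕ) (R₁ R₂ : Set ℤ) : Setoid (SOpen i j R₁ R₂) :=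
  Setoid.ker fun s =>
    DoubleCoset.doubleCoset (s.toAdelic p) (levelK N i j) (levelKV Δ N i j)

/-- D-equivalence of `σ₁` and `σ₂`. -/
def DEquiv (p Δ N : ℕ) (s₁ s₂ : SOpen i j R₁ R₂) : Prop := dSetoid p Δ N i j R₁ R₂ s₁ s₂

/-- The D-partition of `S(g, i)^open`. -/
def dPartition (p Δ N i j : ℕ) (R₁ R₂ : Set ℤ) : Set (Set (SOpen i j R₁ R₂)) :=
  (dSetoid p Δ N i j R₁ R₂).classes

/-- An integral matrix, seen in `ℤ[√-Δ]`. -/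
def real (Δ : ℕ) {m n : Type*} (M : Matrix m n ℤ) : Matrix m n (Quad ℤ Δ) :=
  M.map fun x => ⟨x, 0⟩

/-- An integral matrix times `√-Δ`. -/
def imag (Δ : ℕ) {m n : Type*} (M : Matrix m n ℤ) : Matrix m n (Quad ℤ Δ) :=
  M.map fun x => ⟨0, x⟩

/-- `μ₁(σ) = (-1, -Cᵗ √-Δ; A + C √-Δ, -1 - U √-Δ)`. -/
def mu₁ (Δ : ℕ) (s : SOpen i j R₁ R₂) : Matrix (Ix i j) (Ix i j) (Quad ℤ Δ) :=
  fromBlocks (-1) (-imag Δ s.Cᵀ) (real Δ s.A + imag Δ s.C) (-1 - imag Δ s.U)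

/-- `μ₂(σ) = (√-Δ, -Aᵗ √-Δ; A + C √-Δ, -1 - U √-Δ)`. -/
def mu₂ (Δ : ℕ) (s : SOpen i j R₁ R₂) : Matrix (Ix i j) (Ix i j) (Quad ℤ Δ) :=
  fromBlocks (imag Δ 1) (-imag Δ s.Aᵀ) (real Δ s.A + imag Δ s.C) (-1 - imag Δ s.U)

/-- Reduction modulo `p` of a matrix over `ℤ[√-Δ]`, with entries in `𝔽_p[√-Δ]`. -/
def red (p Δ : ℕ) {m n : Type*} (M : Matrix m n (Quad ℤ Δ)) : Matrix m n (Quad (ZMod p) Δ) :=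
  M.map fun z => ⟨(z.re : ZMod p), (z.im : ZMod p)⟩

/-- `M' = (X₁, X₂; 0, 1) M` for some `X₁`, `X₂` such that the rank of `im X₁` is `k`.  (If `M` is
invertible then `X₁`, `X₂` are unique.) -/
def ImRank (p Δ : ℕ) (M M' : Matrix (Ix i j) (Ix i j) (Quad (ZMod p) Δ)) (k : ℕ) : Prop :=
  ∃ (X₁ : Matrix (Fin i) (Fin i) (Quad (ZMod p) Δ))
    (X₂ : Matrix (Fin i) (Fin j) (Quad (ZMod p) Δ)),
    M' = fromBlocks X₁ X₂ 0 1 * M ∧ (X₁.map QuadraticAlgebra.im).rank = k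

/-- The set `𝔇_*`: both `det μ₁` and `det μ₂` are `0` modulo `p`. -/
def frakDStar (p Δ i j : ℕ) (R₁ R₂ : Set ℤ) : Set (SOpen i j R₁ R₂) :=
  {s | (red p Δ (s.mu₁ Δ)).det = 0 ∧ (red p Δ (s.mu₂ Δ)).det = 0}

/-- The set `𝔇_k`.  If `det μ₁ ≠ 0` modulo `p`, then `σ ∈ 𝔇_k` iff `rank im X₁ = k`, where
`μ₂ = (X₁, X₂; 0, 1) μ₁` modulo `p`; if `det μ₁ = 0` and `det μ₂ ≠ 0` modulo `p`, the roles of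
`μ₁` and `μ₂` are interchanged. -/
def frakD (p Δ i j : ℕ) (R₁ R₂ : Set ℤ) (k : ℕ) : Set (SOpen i j R₁ R₂) :=
  {s | ((red p Δ (s.mu₁ Δ)).det ≠ 0 ∧ ImRank p Δ (red p Δ (s.mu₁ Δ)) (red p Δ (s.mu₂ Δ)) k) ∨
    ((red p Δ (s.mu₁ Δ)).det = 0 ∧ (red p Δ (s.mu₂ Δ)).det ≠ 0 ∧
      ImRank p Δ (red p Δ (s.mu₂ Δ)) (red p Δ (s.mu₁ Δ)) k)}

/-- The `𝔇`-partition of `S(g, i)^open`, with the parts `𝔇_*` and `𝔇_0, …, 𝔇_i`. -/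
def frakDPartition (p Δ i j : ℕ) (R₁ R₂ : Set ℤ) : Set (Set (SOpen i j R₁ R₂)) :=
  insert (frakDStar p Δ i j R₁ R₂) {P | ∃ k ≤ i, P = frakD p Δ i j R₁ R₂ k}

end SOpen

end HeckeUnitary

/-!
The row lattice of `σ` modulo `p` is an `𝔽_p`-subspace `W` of `𝔽_p^{2g}` of dimension `j`, and
through `(x, y) ↦ x - y E √-Δ` it lies in the `g`-dimensional space `V` over `𝔽_p[√-Δ]`, where
`α(𝔤)` acts by multiplication by the conjugate of `𝔤` (`toQuad_mul_alphaMap`). The rows of the row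
lattice that are divisible by `p`, divided by `p`, span modulo `p` the symplectic complement `W^⊥`
of `W`. Both `W` and `W^⊥` are determined by the row lattice alone, so D-equivalence moves them by
right multiplication by a matrix over `𝔽_p[√-Δ]` (`SOpen.DEquiv.exists_zmod`), and the
dimension over `𝔽_p` of `W^⊥ + 𝔽_p[√-Δ] W` is an invariant of D-equivalence (`SOpen.DEquiv.invariant_eq`).

The rows of `μ₁` and `μ₂` are, up to sign, the given generators of `W^⊥` and of `W` in the
coordinates of `V` (`SOpen.toQuad_primitive`): a basis `w` of `W` in the lower block, and in the
upper blocks two families `r`, `r'` that span `W^⊥` together with `w`. If `μ₁` is invertible and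
`r' = X₁ r + X₂ w`, then modulo `𝔽_p[√-Δ] W` the space `W^⊥` is spanned by `r` and `(im X₁) √-Δ r`,
so the invariant is `i + 2 j + k` on `𝔇_k` (`mixedRank_of_eq`). If `i = 1` and both matrices are
singular, then either `w` is dependent over `𝔽_p[√-Δ]` or `r` and `r'` are combinations of `w`, and
in both cases the invariant is at most `2 j` (`mixedRank_le_of_det_eq_zero`). Thus the invariant
separates the parts in question. Only integrality at `p` and reduction modulo `p` enter, so the
finite adeles are needed only through their projection to `ℤ_p`.
-/

namespace HeckeUnitary

open Matrix

variable {i j : ℕ}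

/-! ### From the adelic double coset to matrices over `ℤ_p` -/

/-- The integral adeles project to `ℤ_p`. -/
theorem nonempty_zHat_ringHom_padicInt (p : ℕ) [hp : Fact p.Prime] :
    Nonempty (zHat →+* ℤ_[p]) := by
  let v := (Rat.HeightOneSpectrum.primesEquiv (R := ℤ)).symm ⟨p, hp.out⟩
  let ev : zHat →+* v.adicCompletionIntegers ℚ :=
    { toFun := fun a => ⟨a.1 v, a.2 v⟩
      map_one' := rfl
      map_mul' := fun _ _ => rfl
      map_zero' := rfl
      map_add' := fun _ _ => rfl }
  -- `Ring.toIntAlgebra` is not the `ℤ`-algebra structure that instance search finds here.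
  let e : ℤ_[p] ≃+* v.adicCompletionIntegers ℚ :=
    @AlgEquiv.toRingEquiv _ _ _ _ _ _ _ (Ring.toIntAlgebra _)
      (@ContinuousAlgEquiv.toAlgEquiv _ _ _ _ _ _ _ _ _ (Ring.toIntAlgebra _)
        (PadicInt.adicCompletionIntegersEquiv ℤ ⟨p, hp.out⟩))
  exact ⟨e.symm.toRingHom.comp ev⟩

/-- The map `R[√-Δ] → S[√-Δ]` induced by a ring homomorphism, entrywise on matrices. -/
def mapQuad {R S : Type*} [CommRing R] [CommRing S] (Δ : ℕ) (f : R →+* S) {m n : Type*}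
    (M : Matrix m n (Quad R Δ)) : Matrix m n (Quad S Δ) :=
  M.map fun z => ⟨f z.re, f z.im⟩

theorem sgnE_mul_self (R : Type*) [CommRing R] : sgnE R i j * sgnE R i j = 1 := by
  simp [sgnE, fromBlocks_multiply, fromBlocks_one]

theorem sgnE_map {R S : Type*} [CommRing R] [CommRing S] (f : R →+* S) :
    (sgnE R i j).map f = sgnE S i j := by
  simp [sgnE, fromBlocks_map, Matrix.map_neg]

theorem alphaMap_one (R : Type*) [CommRing R] (Δ : ℕ) : alphaMap R Δ i j 1 = 1 := by
  have h : (1 : Matrix (Ix i j) (Ix i j) (Quad R Δ)).map QuadraticAlgebra.re = 1 := by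
    ext a b; by_cases h : a = b <;> simp [h, Matrix.one_apply, QuadraticAlgebra.re_one]
  have h' : (1 : Matrix (Ix i j) (Ix i j) (Quad R Δ)).map QuadraticAlgebra.im = 0 := by
    ext a b; by_cases h : a = b <;> simp [h, QuadraticAlgebra.im_one]
  simp [alphaMap, h, h', sgnE_mul_self]

theorem alphaMap_mapQuad {R S : Type*} [CommRing R] [CommRing S] (Δ : ℕ) (f : R →+* S)
    (m : Matrix (Ix i j) (Ix i j) (Quad R Δ)) :
    alphaMap S Δ i j (mapQuad Δ f m) = (alphaMap R Δ i j m).map f := by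
  have h : (mapQuad Δ f m).map QuadraticAlgebra.re = (m.map QuadraticAlgebra.re).map f := rfl
  have h' : (mapQuad Δ f m).map QuadraticAlgebra.im = (m.map QuadraticAlgebra.im).map f := rfl
  simp only [alphaMap, h, h', fromBlocks_map, Matrix.map_mul, sgnE_map]
  congr 1
  rw [← sgnE_map f, ← Matrix.map_mul]
  ext a b
  simp only [Matrix.smul_apply, map_apply, smul_eq_mul, map_mul, map_neg, map_natCast]

theorem one_mem_levelK (N : ℕ) : (1 : Matrix (Ix2 i j) (Ix2 i j) Af) ∈ levelK N i j :=
  ⟨1, ⟨⟨1, by simp⟩, 0, by simp⟩, by simp⟩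

theorem one_mem_levelKV (Δ N : ℕ) : (1 : Matrix (Ix2 i j) (Ix2 i j) Af) ∈ levelKV Δ N i j :=
  ⟨one_mem_levelK N, 1, ⟨1, by simp⟩, alphaMap_one Af Δ⟩

/-- The image of `α` is cut out by linear equations with coefficients in the prime ring, so it is
stable under passing to a subring. -/
theorem exists_alphaMap_of_map_eq {R S : Type*} [CommRing R] [CommRing S] {Δ : ℕ} {f : R →+* S}
    (hf : Function.Injective f) {v : Matrix (Ix2 i j) (Ix2 i j) R}
    {m : Matrix (Ix i j) (Ix i j) (Quad S Δ)} (h : alphaMap S Δ i j m = v.map f) :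
    ∃ m', v = alphaMap R Δ i j m' := by
  let k := v.toBlocks₁₂ * sgnE R i j
  refine ⟨.of fun a b => ⟨v.toBlocks₁₁ a b, k a b⟩, Matrix.map_injective hf ?_⟩
  change v.map f = (alphaMap R Δ i j _).map f
  rw [← h, ← alphaMap_mapQuad]
  congr 1
  have h₁ : m.map QuadraticAlgebra.re = v.toBlocks₁₁.map f := by
    have := congrArg toBlocks₁₁ h
    simpa only [alphaMap, toBlocks_fromBlocks₁₁] using! this
  have h₂ : m.map QuadraticAlgebra.im = k.map f := by
    have := congrArg toBlocks₁₂ h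
    simp only [alphaMap, toBlocks_fromBlocks₁₂] at this
    rw [Matrix.map_mul, sgnE_map]
    change _ = (v.map f).toBlocks₁₂ * _
    rw [← this, Matrix.mul_assoc, sgnE_mul_self, Matrix.mul_one]
  ext a b
  · exact congrFun (congrFun h₁ a) b
  · exact congrFun (congrFun h₂ a) b

theorem exists_mul_eq_one_of_mem_GSp {R : Type*} [CommRing R]
    {m : Matrix (Ix2 i j) (Ix2 i j) R} (hm : m ∈ GSp R i j) : ∃ m', m * m' = 1 := by
  obtain ⟨c, hc⟩ := hm
  refine ⟨(↑c⁻¹ : R) • (J (Ix i j) R * mᵀ * -J (Ix i j) R), ?_⟩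
  rw [Matrix.mul_smul, ← Matrix.mul_assoc, ← Matrix.mul_assoc, hc, Matrix.smul_mul,
    Matrix.mul_neg, J_squared, neg_neg, smul_smul]
  simp

/-- D-equivalence yields an equation `σ₁ = κ σ₂ α(m)` over `ℤ_p`, with `α(m)` invertible. -/
theorem SOpen.DEquiv.exists_padicInt {p : ℕ} [Fact p.Prime] {Δ N : ℕ} {R₁ R₂ : Set ℤ}
    {s₁ s₂ : SOpen i j R₁ R₂} (h : SOpen.DEquiv p Δ N s₁ s₂) :
    ∃ (κ : Matrix (Ix2 i j) (Ix2 i j) ℤ_[p]) (m : Matrix (Ix i j) (Ix i j) (Quad ℤ_[p] Δ))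
      (α' : Matrix (Ix2 i j) (Ix2 i j) ℤ_[p]),
      (s₁.toMatrix p).map (Int.cast : ℤ → ℤ_[p]) =
        κ * (s₂.toMatrix p).map (Int.cast : ℤ → ℤ_[p]) * alphaMap ℤ_[p] Δ i j m ∧
      alphaMap ℤ_[p] Δ i j m * α' = 1 := by
  have hmem : s₁.toAdelic p ∈
      DoubleCoset.doubleCoset (s₂.toAdelic p) (levelK N i j) (levelKV Δ N i j) := by
    have h' : DoubleCoset.doubleCoset (s₁.toAdelic p) (levelK N i j) (levelKV Δ N i j) =
      DoubleCoset.doubleCoset (s₂.toAdelic p) (levelK N i j) (levelKV Δ N i j) := h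
    rw [← h', DoubleCoset.mem_doubleCoset]
    exact ⟨1, one_mem_levelK N, 1, one_mem_levelKV Δ N, by simp⟩
  obtain ⟨_, ⟨κ, -, rfl⟩, _, ⟨⟨v, ⟨hv, -⟩, rfl⟩, m, -, hm⟩, heq⟩ :=
    DoubleCoset.mem_doubleCoset.1 hmem
  obtain ⟨φ⟩ := nonempty_zHat_ringHom_padicInt p
  have hinj : Function.Injective zHat.subtype := Subtype.val_injective
  obtain ⟨m', rfl⟩ := exists_alphaMap_of_map_eq hinj hm
  obtain ⟨α', hα'⟩ := exists_mul_eq_one_of_mem_GSp hv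
  have hcast (s : SOpen i j R₁ R₂) : s.toAdelic p =
      ((s.toMatrix p).map (Int.cast : ℤ → zHat)).map zHat.subtype := by
    ext a b; simp [SOpen.toAdelic]
  rw [hcast, hcast] at heq
  dsimp only at heq
  rw [← Matrix.map_mul, ← Matrix.map_mul] at heq
  have heq' := congrArg (fun M => M.map φ) (Matrix.map_injective hinj heq)
  have hcast' (s : SOpen i j R₁ R₂) :
      ((s.toMatrix p).map (Int.cast : ℤ → zHat)).map φ =
        (s.toMatrix p).map (Int.cast : ℤ → ℤ_[p]) := by
    ext a b; simp
  refine ⟨κ.map φ, mapQuad Δ φ m', α'.map φ,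
    ?_, ?_⟩
  · rw [alphaMap_mapQuad]
    simpa only [Matrix.map_mul, hcast'] using heq'
  · rw [alphaMap_mapQuad, ← Matrix.map_mul, hα']
    simp

/-! ### Reduction modulo `p` -/

namespace SOpen

variable {R₁ R₂ : Set ℤ}

/-- The factor by which the rows of `σ` in each block are divisible: `p`, `1`, `p`, `p`. -/
def rowScale (p : ℕ) : Ix2 i j → ℤ
  | .inl (.inl _) => p
  | .inl (.inr _) => 1
  | .inr _ => p

/-- The matrix `σ` with its rows divided by `rowScale`. -/
def primitive (p : ℕ) (s : SOpen i j R₁ R₂) : Matrix (Ix2 i j) (Ix2 i j) ℤ :=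
  fromBlocks
    (fromBlocks 1 0 (-s.A) 1) (fromBlocks 0 s.Cᵀ s.C s.U)
    0 (fromBlocks 1 s.Aᵀ 0 ((p : ℤ) • 1))

theorem toMatrix_apply (p : ℕ) (s : SOpen i j R₁ R₂) (x y : Ix2 i j) :
    s.toMatrix p x y = rowScale p x * s.primitive p x y := by
  rcases x with (a | a) | (a | a) <;> rcases y with (b | b) | (b | b) <;>
    simp only [toMatrix, primitive, rowScale, fromBlocks_apply₁₁, fromBlocks_apply₁₂,
      fromBlocks_apply₂₁, fromBlocks_apply₂₂, Matrix.smul_apply, smul_eq_mul, transpose_apply,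
      Matrix.zero_apply, mul_zero, one_mul, pow_two, mul_assoc]

theorem toMatrix_inl_inr (p : ℕ) (s : SOpen i j R₁ R₂) (x : Ix2 i j) (b : Fin j) :
    s.toMatrix p x (.inl (.inr b)) = if x = .inl (.inr b) then 1 else 0 := by
  rcases x with (a | a) | (a | a) <;> simp [toMatrix, Matrix.one_apply]

/-- D-equivalence modulo `p`: the rows in the second block of `σ₁`, and the rows of `σ₁` in the
other blocks divided by `p`, are obtained from those of `σ₂` by a matrix `Θ`, up to the action of
`α(m)`.  The second block of `σ₁` only involves the second block of `σ₂`. -/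
theorem DEquiv.exists_zmod {p : ℕ} [Fact p.Prime] {Δ N : ℕ}
    {s₁ s₂ : SOpen i j R₁ R₂} (h : SOpen.DEquiv p Δ N s₁ s₂) :
    ∃ (Θ : Matrix (Ix2 i j) (Ix2 i j) (ZMod p)) (m : Matrix (Ix i j) (Ix i j) (Quad (ZMod p) Δ)),
      (s₁.primitive p).map (Int.cast : ℤ → ZMod p) =
        Θ * (s₂.primitive p).map (Int.cast : ℤ → ZMod p) * alphaMap (ZMod p) Δ i j m ∧
      ∀ b x, (∀ b', x ≠ .inl (.inr b')) → Θ (.inl (.inr b)) x = 0 := by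
  obtain ⟨κ, m, α', heq, hα'⟩ := h.exists_padicInt
  have hp0 : (p : ℤ_[p]) ≠ 0 := by exact_mod_cast (Fact.out : p.Prime).ne_zero
  have hκ : (s₁.toMatrix p).map (Int.cast : ℤ → ℤ_[p]) * α' =
      κ * (s₂.toMatrix p).map (Int.cast : ℤ → ℤ_[p]) := by
    rw [heq, Matrix.mul_assoc, hα', Matrix.mul_one]
  -- Compare the entries of `σ₁ α' = κ σ₂` in the second block of columns, where those of
  -- `σ₂` are `(0, 1, 0, 0)`.
  have hcol (x : Ix2 i j) (b : Fin j) :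
      κ x (.inl (.inr b)) = rowScale p x *
        ((s₁.primitive p).map (Int.cast : ℤ → ℤ_[p]) * α') x (.inl (.inr b)) := by
    have := congrFun (congrFun hκ x) (.inl (.inr b))
    simp only [Matrix.mul_apply, Matrix.map_apply, toMatrix_inl_inr, Int.cast_ite, Int.cast_one,
      Int.cast_zero, mul_ite, mul_one, mul_zero, Finset.sum_ite_eq', Finset.mem_univ, if_true,
      toMatrix_apply p s₁, Int.cast_mul, mul_assoc, ← Finset.mul_sum] at this
    exact this.symm
  have hdvd (x y : Ix2 i j) : ∃ t : ℤ_[p], κ x y * rowScale p y = rowScale p x * t ∧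
      ((∃ b, x = .inl (.inr b)) → (∀ b', y ≠ .inl (.inr b')) → PadicInt.toZMod t = 0) := by
    rcases x with (a | a) | a
    · rcases y with (b | b) | b
      · exact ⟨κ _ _, mul_comm _ _, by simp⟩
      · exact ⟨_, by rw [hcol, mul_assoc], by simp⟩
      · exact ⟨κ _ _, mul_comm _ _, by simp⟩
    · refine ⟨κ (.inl (.inr a)) y * rowScale p y, by simp [rowScale], fun _ hy => ?_⟩
      rcases y with (b | b) | b
      · simp [rowScale]
      · exact absurd rfl (hy b)
      · simp [rowScale]
    · rcases y with (b | b) | b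
      · exact ⟨κ _ _, mul_comm _ _, by simp⟩
      · exact ⟨_, by rw [hcol, mul_assoc], by simp⟩
      · exact ⟨κ _ _, mul_comm _ _, by simp⟩
  choose Θ hΘ hΘ0 using hdvd
  have hprim : (s₁.primitive p).map (Int.cast : ℤ → ℤ_[p]) =
      .of Θ * (s₂.primitive p).map (Int.cast : ℤ → ℤ_[p]) * alphaMap ℤ_[p] Δ i j m := by
    have hκΘ : κ * (s₂.toMatrix p).map (Int.cast : ℤ → ℤ_[p]) =
        diagonal (fun x => (rowScale p x : ℤ_[p])) *
          (.of Θ * (s₂.primitive p).map (Int.cast : ℤ → ℤ_[p])) := by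
      ext x z
      rw [diagonal_mul]
      simp only [Matrix.mul_apply, Matrix.map_apply, toMatrix_apply, Int.cast_mul,
        Matrix.of_apply, Finset.mul_sum, ← mul_assoc, hΘ]
    rw [hκΘ, Matrix.mul_assoc] at heq
    ext x z
    have := congrFun (congrFun heq x) z
    rw [diagonal_mul, Matrix.map_apply, toMatrix_apply, Int.cast_mul] at this
    refine mul_left_cancel₀ ?_ this
    rcases x with (a | a) | a <;> simp [rowScale, hp0]
  refine ⟨(Matrix.of Θ).map PadicInt.toZMod, mapQuad Δ PadicInt.toZMod m, ?_, fun b x hx => ?_⟩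
  · have := congrArg (fun M => M.map (PadicInt.toZMod (p := p))) hprim
    have hc (s : SOpen i j R₁ R₂) :
        ((s.primitive p).map (Int.cast : ℤ → ℤ_[p])).map (PadicInt.toZMod (p := p)) =
          (s.primitive p).map (Int.cast : ℤ → ZMod p) := by
      ext a b; simp
    rw [alphaMap_mapQuad]
    simpa only [Matrix.map_mul, hc] using this
  · exact hΘ0 _ x ⟨b, rfl⟩ hx

end SOpen

/-! ### The complex structure -/

/-- The row vectors `(x, y)` of length `2g` as row vectors `x - y E √-Δ` of length `g`; a matrix is
treated row by row. -/
def toQuad {R : Type*} [CommRing R] (Δ : ℕ) {n : Type*} (M : Matrix n (Ix2 i j) R) :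
    Matrix n (Ix i j) (Quad R Δ) :=
  .of fun a b => ⟨M.toCols₁ a b, -(M.toCols₂ * sgnE R i j) a b⟩

theorem toQuad_map_re {R : Type*} [CommRing R] {Δ : ℕ} {n : Type*} (M : Matrix n (Ix2 i j) R) :
    (toQuad Δ M).map QuadraticAlgebra.re = M.toCols₁ := rfl

theorem toQuad_map_im {R : Type*} [CommRing R] {Δ : ℕ} {n : Type*} (M : Matrix n (Ix2 i j) R) :
    (toQuad Δ M).map QuadraticAlgebra.im = -(M.toCols₂ * sgnE R i j) := rfl

theorem re_sum {R : Type*} [CommRing R] {Δ : ℕ} {n : Type*} [Fintype n] (f : n → Quad R Δ) :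
    (∑ x, f x).re = ∑ x, (f x).re :=
  map_sum (QuadraticAlgebra.reₗ (-(Δ : R)) 0) f _

theorem im_sum {R : Type*} [CommRing R] {Δ : ℕ} {n : Type*} [Fintype n] (f : n → Quad R Δ) :
    (∑ x, f x).im = ∑ x, (f x).im :=
  map_sum (QuadraticAlgebra.imₗ (-(Δ : R)) 0) f _

theorem map_re_mul {R : Type*} [CommRing R] {Δ : ℕ} {l n o : Type*} [Fintype n]
    (A : Matrix l n (Quad R Δ)) (B : Matrix n o (Quad R Δ)) :
    (A * B).map QuadraticAlgebra.re = A.map QuadraticAlgebra.re * B.map QuadraticAlgebra.re -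
      (Δ : R) • (A.map QuadraticAlgebra.im * B.map QuadraticAlgebra.im) := by
  ext a b
  simp [Matrix.mul_apply, re_sum, Finset.sum_add_distrib, Finset.mul_sum, sub_eq_add_neg, mul_assoc]

theorem map_im_mul {R : Type*} [CommRing R] {Δ : ℕ} {l n o : Type*} [Fintype n]
    (A : Matrix l n (Quad R Δ)) (B : Matrix n o (Quad R Δ)) :
    (A * B).map QuadraticAlgebra.im = A.map QuadraticAlgebra.re * B.map QuadraticAlgebra.im +
      A.map QuadraticAlgebra.im * B.map QuadraticAlgebra.re := by
  ext a b
  simp [Matrix.mul_apply, im_sum, Finset.sum_add_distrib]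

theorem ext_re_im {R : Type*} [CommRing R] {Δ : ℕ} {l n : Type*} {A B : Matrix l n (Quad R Δ)}
    (hre : A.map QuadraticAlgebra.re = B.map QuadraticAlgebra.re)
    (him : A.map QuadraticAlgebra.im = B.map QuadraticAlgebra.im) : A = B := by
  ext a b
  · exact congrFun (congrFun hre a) b
  · exact congrFun (congrFun him a) b

/-- The coordinates `x - y E √-Δ` turn the right action of `α(m)` into that of the conjugate
of `m`. -/
theorem toQuad_mul_alphaMap {R : Type*} [CommRing R] (Δ : ℕ) {n : Type*}
    (M : Matrix n (Ix2 i j) R) (m : Matrix (Ix i j) (Ix i j) (Quad R Δ)) :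
    toQuad Δ (M * alphaMap R Δ i j m) = toQuad Δ M * m.map star := by
  have hre' : (m.map star).map QuadraticAlgebra.re = m.map QuadraticAlgebra.re := by
    ext a b; simp
  have him' : (m.map star).map QuadraticAlgebra.im = -m.map QuadraticAlgebra.im := by
    ext a b; simp
  have hmul : M * alphaMap R Δ i j m = fromCols
      (M.toCols₁ * m.map QuadraticAlgebra.re +
        M.toCols₂ * (-(Δ : R) • (sgnE R i j * m.map QuadraticAlgebra.im)))
      (M.toCols₁ * (m.map QuadraticAlgebra.im * sgnE R i j) +
        M.toCols₂ * (sgnE R i j * m.map QuadraticAlgebra.re * sgnE R i j)) := by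
    conv_lhs => rw [← fromCols_toCols M, alphaMap, fromCols_mul_fromBlocks]
  apply ext_re_im
  · rw [map_re_mul, toQuad_map_re, toQuad_map_re, toQuad_map_im, hre', him', hmul, toCols₁_fromCols]
    simp [Matrix.mul_assoc, sub_eq_add_neg]
  · rw [map_im_mul, toQuad_map_re, toQuad_map_im, toQuad_map_im, hre', him', hmul, toCols₂_fromCols,
      Matrix.add_mul]
    simp only [Matrix.mul_assoc, sgnE_mul_self, Matrix.mul_one, Matrix.mul_neg, Matrix.neg_mul]
    abel

theorem toQuad_mul {R : Type*} [CommRing R] (Δ : ℕ) {l n : Type*} [Fintype n] (Θ : Matrix l n R)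
    (M : Matrix n (Ix2 i j) R) :
    toQuad Δ (Θ * M) = Θ.map (algebraMap R (Quad R Δ)) * toQuad Δ M := by
  have hre' : (Θ.map (algebraMap R (Quad R Δ))).map QuadraticAlgebra.re = Θ := by
    ext a b; simp
  have him' : (Θ.map (algebraMap R (Quad R Δ))).map QuadraticAlgebra.im = 0 := by
    ext a b; simp
  have h₁ : (Θ * M).toCols₁ = Θ * M.toCols₁ := rfl
  have h₂ : (Θ * M).toCols₂ = Θ * M.toCols₂ := rfl
  apply ext_re_im
  · rw [map_re_mul, hre', him', toQuad_map_re, toQuad_map_re, h₁]; simp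
  · rw [map_im_mul, hre', him', toQuad_map_im, toQuad_map_im, h₂]; simp [Matrix.mul_assoc]

namespace SOpen

variable {R₁ R₂ : Set ℤ}

/-- The rows of `primitive σ` modulo `p` are, up to sign, the rows of `μ₁` and of `μ₂`. -/
theorem toQuad_primitive (p Δ : ℕ) (s : SOpen i j R₁ R₂) :
    toQuad Δ ((s.primitive p).map (Int.cast : ℤ → ZMod p)) =
      -fromRows (red p Δ (s.mu₁ Δ)) (fromRows (red p Δ (s.mu₂ Δ)).toRows₁ 0) := by
  have hE : sgnE (ZMod p) i j = diagonal (Sum.elim (fun _ => 1) (fun _ => -1)) := by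
    rw [← fromBlocks_diagonal, diagonal_one, ← diagonal_neg, diagonal_one, sgnE]
  ext x y <;> rcases x with (a | a) | (a | a) <;> rcases y with b | b <;>
    simp [toQuad, primitive, red, mu₁, mu₂, real, imag, hE, mul_diagonal, toCols₁, toCols₂,
      toRows₁, Matrix.one_apply]
  case re.inl.inl.inl | re.inl.inr.inr | im.inl.inl.inl | im.inl.inr.inr =>
    split <;> simp [QuadraticAlgebra.re_one, QuadraticAlgebra.im_one]
  case im.inr.inr.inr => simp [← Matrix.diagonal_natCast, diagonal_apply, apply_ite]

end SOpen

/-! ### The rank invariant -/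

section RankInvariant

variable {p Δ : ℕ}

/-- The `𝔽_p`-linear map `(a, c, d) ↦ a r + c r' + d w`, where the coefficients `a`, `c` are over
`𝔽_p` and `d` is over `𝔽_p[√-Δ]`. -/
noncomputable def combine {n : Type*} (r r' : Matrix (Fin i) n (Quad (ZMod p) Δ))
    (w : Matrix (Fin j) n (Quad (ZMod p) Δ)) :
    ((Fin i → ZMod p) × (Fin i → ZMod p) × (Fin j → Quad (ZMod p) Δ)) →ₗ[ZMod p]
      (n → Quad (ZMod p) Δ) where
  toFun x := (algebraMap _ (Quad (ZMod p) Δ) ∘ x.1) ᵥ* r +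
    (algebraMap _ (Quad (ZMod p) Δ) ∘ x.2.1) ᵥ* r' + x.2.2 ᵥ* w
  map_add' x y := by
    ext b <;> simp [vecMul, dotProduct, add_mul, Finset.sum_add_distrib] <;> ring
  map_smul' c x := by
    ext b : 1
    simp [vecMul, dotProduct, Algebra.smul_def, mul_assoc]
    simp only [mul_add, Finset.mul_sum]

theorem combine_apply {n : Type*} (r r' : Matrix (Fin i) n (Quad (ZMod p) Δ))
    (w : Matrix (Fin j) n (Quad (ZMod p) Δ)) (x) :
    combine r r' w x = (algebraMap _ (Quad (ZMod p) Δ) ∘ x.1) ᵥ* r +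
      (algebraMap _ (Quad (ZMod p) Δ) ∘ x.2.1) ᵥ* r' + x.2.2 ᵥ* w := rfl

/-- The dimension over `𝔽_p` of the space spanned by the rows of `r`, `r'` over `𝔽_p` and by the
rows of `w` over `𝔽_p[√-Δ]`. -/
noncomputable def mixedRank {n : Type*} (r r' : Matrix (Fin i) n (Quad (ZMod p) Δ))
    (w : Matrix (Fin j) n (Quad (ZMod p) Δ)) : ℕ :=
  Module.finrank (ZMod p) (LinearMap.range (combine r r' w))

theorem mixedRank_comm {n : Type*} (r r' : Matrix (Fin i) n (Quad (ZMod p) Δ))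
    (w : Matrix (Fin j) n (Quad (ZMod p) Δ)) : mixedRank r r' w = mixedRank r' r w := by
  have h : LinearMap.range (combine r r' w) = LinearMap.range (combine r' r w) := by
    ext v
    constructor
    all_goals
      rintro ⟨x, rfl⟩
      exact ⟨(x.2.1, x.1, x.2.2), by simp only [combine_apply, add_comm]⟩
  rw [mixedRank, h, mixedRank]

variable [Fact p.Prime]

theorem mixedRank_add_finrank_ker {n : Type*} (r r' : Matrix (Fin i) n (Quad (ZMod p) Δ))
    (w : Matrix (Fin j) n (Quad (ZMod p) Δ)) :
    mixedRank r r' w + Module.finrank (ZMod p) (LinearMap.ker (combine r r' w)) =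
      2 * i + 2 * j := by
  rw [mixedRank, LinearMap.finrank_range_add_finrank_ker]
  simp [Module.finrank_prod, Module.finrank_pi_fintype, QuadraticAlgebra.finrank_eq_two]
  ring

/-- If `r` and `w` together form an invertible matrix and `r' = X₁ r + X₂ w`, then
`a r + c r' + d w` vanishes iff `c · im X₁ = 0`, `a = - c · re X₁` and `d = - c X₂`. -/
theorem mixedRank_of_eq {k : ℕ} {M M' : Matrix (Ix i j) (Ix i j) (Quad (ZMod p) Δ)}
    (hM : IsUnit M.det) (h : SOpen.ImRank p Δ M M' k) :
    mixedRank M.toRows₁ M'.toRows₁ M.toRows₂ = i + 2 * j + k := by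
  obtain ⟨X₁, X₂, hX, rfl⟩ := h
  have hr' : M'.toRows₁ = X₁ * M.toRows₁ + X₂ * M.toRows₂ := by
    conv_lhs => rw [hX, ← fromRows_toRows M, fromBlocks_mul_fromRows]
    simp
  have hinj (u : Ix i j → Quad (ZMod p) Δ) (hu : u ᵥ* M = 0) : u = 0 := by
    have := congrArg (· ᵥ* M⁻¹) hu
    simpa [vecMul_vecMul, mul_nonsing_inv M hM] using this
  have hsplit (x) : combine M.toRows₁ M'.toRows₁ M.toRows₂ x =
      Sum.elim (algebraMap _ (Quad (ZMod p) Δ) ∘ x.1 +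
        (algebraMap _ (Quad (ZMod p) Δ) ∘ x.2.1) ᵥ* X₁)
        (x.2.2 + (algebraMap _ (Quad (ZMod p) Δ) ∘ x.2.1) ᵥ* X₂) ᵥ* M := by
    conv_rhs => rw [← fromRows_toRows M, sumElim_vecMul_fromRows]
    rw [combine_apply, hr', vecMul_add, add_vecMul, add_vecMul, vecMul_vecMul, vecMul_vecMul]
    abel
  have hre (c : Fin i → ZMod p) (a : Fin i) :
      (((algebraMap _ (Quad (ZMod p) Δ) ∘ c) ᵥ* X₁) a).re =
        (c ᵥ* X₁.map QuadraticAlgebra.re) a := by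
    simp [vecMul, dotProduct, re_sum]
  have him (c : Fin i → ZMod p) (a : Fin i) :
      (((algebraMap _ (Quad (ZMod p) Δ) ∘ c) ᵥ* X₁) a).im =
        (c ᵥ* X₁.map QuadraticAlgebra.im) a := by
    simp [vecMul, dotProduct, im_sum]
  have hmem (x) : x ∈ LinearMap.ker (combine M.toRows₁ M'.toRows₁ M.toRows₂) ↔
      x.2.1 ᵥ* X₁.map QuadraticAlgebra.im = 0 ∧ x.1 = -(x.2.1 ᵥ* X₁.map QuadraticAlgebra.re) ∧
        x.2.2 = -((algebraMap _ (Quad (ZMod p) Δ) ∘ x.2.1) ᵥ* X₂) := by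
    rw [LinearMap.mem_ker, hsplit]
    constructor
    · intro h0
      have h0 := hinj _ h0
      have h₁ (a : Fin i) := congrFun h0 (.inl a)
      have h₂ (a : Fin j) := congrFun h0 (.inr a)
      refine ⟨?_, ?_, ?_⟩
      · ext a
        have := congrArg QuadraticAlgebra.im (h₁ a)
        simpa [him] using this
      · ext a
        have := congrArg QuadraticAlgebra.re (h₁ a)
        simpa [hre, ← eq_neg_iff_add_eq_zero] using this
      · funext a
        have := h₂ a
        simpa [← eq_neg_iff_add_eq_zero] using this
    · rintro ⟨h₁, h₂, h₃⟩
      rw [h₂, h₃]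
      convert zero_vecMul M
      ext (a | a) <;> simp [hre, him, h₁]
  have hker : Module.finrank (ZMod p)
      (LinearMap.ker (combine M.toRows₁ M'.toRows₁ M.toRows₂)) =
      Module.finrank (ZMod p) (LinearMap.ker (X₁.map QuadraticAlgebra.im)ᵀ.mulVecLin) := by
    refine le_antisymm ?_ ?_
    · let f : LinearMap.ker (combine M.toRows₁ M'.toRows₁ M.toRows₂) →ₗ[ZMod p]
          LinearMap.ker (X₁.map QuadraticAlgebra.im)ᵀ.mulVecLin :=
        ((LinearMap.fst _ _ _ ∘ₗ LinearMap.snd _ _ _).comp (Submodule.subtype _)).codRestrict _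
          fun x => by
            rw [LinearMap.mem_ker, mulVecLin_apply, mulVec_transpose]
            exact ((hmem x.1).1 x.2).1
      refine LinearMap.finrank_le_finrank_of_injective (f := f) ?_
      rintro ⟨x, hx⟩ ⟨y, hy⟩ hxy
      have hxy : x.2.1 = y.2.1 := congrArg Subtype.val hxy
      have hx := (hmem x).1 hx
      have hy := (hmem y).1 hy
      refine Subtype.ext (Prod.ext ?_ (Prod.ext hxy ?_))
      · change x.1 = y.1
        rw [hx.2.1, hy.2.1, hxy]
      · change x.2.2 = y.2.2
        rw [hx.2.2, hy.2.2, hxy]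
    · let f : (Fin i → ZMod p) →ₗ[ZMod p]
          (Fin i → ZMod p) × (Fin i → ZMod p) × (Fin j → Quad (ZMod p) Δ) :=
        { toFun := fun c => (-(c ᵥ* X₁.map QuadraticAlgebra.re), c,
            -((algebraMap _ (Quad (ZMod p) Δ) ∘ c) ᵥ* X₂))
          map_add' := fun c c' => by
            refine Prod.ext ?_ (Prod.ext rfl ?_)
            · simp [add_vecMul, add_comm]
            · ext a <;> simp [vecMul, dotProduct, add_mul, Finset.sum_add_distrib] <;> ring
          map_smul' := fun t c => by
            refine Prod.ext ?_ (Prod.ext rfl ?_)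
            · simp [smul_vecMul]
            · ext a : 1
              simp [vecMul, dotProduct, Finset.mul_sum, Algebra.smul_def, mul_assoc] }
      let f' : LinearMap.ker (X₁.map QuadraticAlgebra.im)ᵀ.mulVecLin →ₗ[ZMod p]
          LinearMap.ker (combine M.toRows₁ M'.toRows₁ M.toRows₂) :=
        (f.comp (Submodule.subtype _)).codRestrict _ fun c => by
          have hc := c.2
          rw [LinearMap.mem_ker, mulVecLin_apply, mulVec_transpose] at hc
          exact (hmem _).2 ⟨hc, rfl, rfl⟩
      refine LinearMap.finrank_le_finrank_of_injective (f := f') ?_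
      rintro ⟨x, hx⟩ ⟨y, hy⟩ hxy
      exact Subtype.ext (congrArg (fun z => z.1.2.1) hxy)
  have h₁ := mixedRank_add_finrank_ker M.toRows₁ M'.toRows₁ M.toRows₂
  have h₂ := LinearMap.finrank_range_add_finrank_ker (X₁.map QuadraticAlgebra.im)ᵀ.mulVecLin
  rw [hker] at h₁
  have h₃ : Module.finrank (ZMod p) (LinearMap.range (X₁.map QuadraticAlgebra.im)ᵀ.mulVecLin) =
    (X₁.map QuadraticAlgebra.im).rank := rank_transpose _
  rw [h₃, Module.finrank_fin_fun] at h₂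
  omega

/-- If both `(r, w)` and `(r', w)` are degenerate, where `r`, `r'` are single rows, then either the
rows of `w` are dependent or both `r` and `r'` are combinations of them; in both cases there is a
plane of relations over `𝔽_p`. -/
theorem mixedRank_le_of_det_eq_zero
    (hfield : ∀ t : ZMod p, t ^ 2 ≠ -(Δ : ZMod p) + 0 * t)
    {M M' : Matrix (Ix 1 j) (Ix 1 j) (Quad (ZMod p) Δ)} (hw : M'.toRows₂ = M.toRows₂)
    (hM : M.det = 0) (hM' : M'.det = 0) :
    mixedRank M.toRows₁ M'.toRows₁ M.toRows₂ ≤ 2 * j := by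
  have : Fact (∀ t : ZMod p, t ^ 2 ≠ -(Δ : ZMod p) + 0 * t) := ⟨hfield⟩
  have hsum := mixedRank_add_finrank_ker M.toRows₁ M'.toRows₁ M.toRows₂
  suffices 2 ≤ Module.finrank (ZMod p)
      (LinearMap.ker (combine M.toRows₁ M'.toRows₁ M.toRows₂)) by omega
  -- A relation among the rows of `w` may be multiplied by any scalar of `𝔽_p[√-Δ]`.
  have hdep (d : Fin j → Quad (ZMod p) Δ) (hd : d ≠ 0) (h : d ᵥ* M.toRows₂ = 0) :
      2 ≤ Module.finrank (ZMod p)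
        (LinearMap.ker (combine M.toRows₁ M'.toRows₁ M.toRows₂)) := by
    let f : Quad (ZMod p) Δ →ₗ[ZMod p]
        (Fin 1 → ZMod p) × (Fin 1 → ZMod p) × (Fin j → Quad (ZMod p) Δ) :=
      LinearMap.inr _ _ _ ∘ₗ LinearMap.inr _ _ _ ∘ₗ
        (LinearMap.toSpanSingleton (Quad (ZMod p) Δ) _ d).restrictScalars (ZMod p)
    have hf (z) : f z ∈ LinearMap.ker (combine M.toRows₁ M'.toRows₁ M.toRows₂) := by
      rw [LinearMap.mem_ker, combine_apply]
      have h0 : (algebraMap (ZMod p) (Quad (ZMod p) Δ) ∘ (0 : Fin 1 → ZMod p)) = 0 := by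
        ext <;> simp
      simp [f, h0, smul_vecMul, h]
    rw [← QuadraticAlgebra.finrank_eq_two (-(Δ : ZMod p)) 0]
    refine LinearMap.finrank_le_finrank_of_injective (f := f.codRestrict _ hf) ?_
    intro x y hxy
    have : x • d = y • d := congrArg (fun z => z.1.2.2) hxy
    obtain ⟨a, ha⟩ := Function.ne_iff.1 hd
    exact mul_right_cancel₀ ha (congrFun this a)
  have hrel {M : Matrix (Ix 1 j) (Ix 1 j) (Quad (ZMod p) Δ)} (hM : M.det = 0) :
      (∃ d, d ≠ 0 ∧ d ᵥ* M.toRows₂ = 0) ∨ ∃ d, M.toRows₁ 0 + d ᵥ* M.toRows₂ = 0 := by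
    obtain ⟨u, hu, hu0⟩ := exists_vecMul_eq_zero_iff.2 hM
    have hu' : u (.inl 0) • M.toRows₁ 0 + (u ∘ .inr) ᵥ* M.toRows₂ = 0 := by
      rw [← hu0]
      funext b
      simp [vecMul, dotProduct, toRows₁, toRows₂]
    by_cases h : u (.inl 0) = 0
    · refine .inl ⟨u ∘ .inr, fun h' => hu ?_, by simpa [h] using hu'⟩
      funext x
      rcases x with x | x
      · rw [Subsingleton.elim x 0, h]; rfl
      · exact congrFun h' x
    · refine .inr ⟨(u (.inl 0))⁻¹ • (u ∘ .inr), ?_⟩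
      have := congrArg ((u (.inl 0))⁻¹ • ·) hu'
      simpa [smul_add, smul_smul, inv_mul_cancel₀ h, smul_vecMul] using this
  rcases hrel hM with ⟨d, hd, h⟩ | ⟨d, h⟩
  · exact hdep d hd h
  rcases hrel hM' with ⟨d', hd', h'⟩ | ⟨d', h'⟩
  · exact hdep d' hd' (hw ▸ h')
  rw [hw] at h'
  let f : (ZMod p × ZMod p) →ₗ[ZMod p]
      (Fin 1 → ZMod p) × (Fin 1 → ZMod p) × (Fin j → Quad (ZMod p) Δ) :=
    { toFun := fun x => (fun _ => x.1, fun _ => x.2, x.1 • d + x.2 • d')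
      map_add' := fun x y => by
        refine Prod.ext rfl (Prod.ext rfl ?_)
        simp only [Prod.fst_add, Prod.snd_add, add_smul]
        abel
      map_smul' := fun t x => by
        refine Prod.ext rfl (Prod.ext rfl ?_)
        simp [smul_smul] }
  have hf (z) : f z ∈ LinearMap.ker (combine M.toRows₁ M'.toRows₁ M.toRows₂) := by
    rw [LinearMap.mem_ker, combine_apply]
    have h1 (t : ZMod p) (R : Matrix (Fin 1) (Ix 1 j) (Quad (ZMod p) Δ)) :
        (algebraMap (ZMod p) (Quad (ZMod p) Δ) ∘ fun _ : Fin 1 => t) ᵥ* R = t • R 0 := by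
      funext b
      simp [vecMul, dotProduct, Algebra.smul_def]
    change (algebraMap (ZMod p) (Quad (ZMod p) Δ) ∘ fun _ : Fin 1 => z.1) ᵥ* M.toRows₁ +
      (algebraMap (ZMod p) (Quad (ZMod p) Δ) ∘ fun _ : Fin 1 => z.2) ᵥ* M'.toRows₁ +
      (z.1 • d + z.2 • d') ᵥ* M.toRows₂ = 0
    rw [h1, h1, add_vecMul, smul_vecMul, smul_vecMul, add_add_add_comm, ← smul_add, ← smul_add, h,
      h']
    simp
  have h2 : Module.finrank (ZMod p) (ZMod p × ZMod p) = 2 := by simp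
  rw [← h2]
  refine LinearMap.finrank_le_finrank_of_injective (f := f.codRestrict _ hf) ?_
  intro x y hxy
  exact Prod.ext (congrArg (fun z => z.1.1 0) hxy) (congrArg (fun z => z.1.2.1 0) hxy)

end RankInvariant

/-! ### The partitions -/

namespace SOpen

variable {R₁ R₂ : Set ℤ} {p Δ : ℕ}

theorem red_mu₂_toRows₂ (s : SOpen i j R₁ R₂) :
    (red p Δ (s.mu₂ Δ)).toRows₂ = (red p Δ (s.mu₁ Δ)).toRows₂ := rfl

/-- The dimension over `𝔽_p` of `W^⊥ + 𝔽_p[√-Δ] W`, where `W` is the image of the row lattice of `σ`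
modulo `p` and `W^⊥` is its symplectic complement. -/
noncomputable def invariant (p Δ : ℕ) (s : SOpen i j R₁ R₂) : ℕ :=
  mixedRank (red p Δ (s.mu₁ Δ)).toRows₁ (red p Δ (s.mu₂ Δ)).toRows₁ (red p Δ (s.mu₁ Δ)).toRows₂

/-- The space that `invariant` measures, in terms of the matrix `primitive σ`: the coefficients of
the rows outside the second block are to be in `𝔽_p`. -/
theorem mem_range_combine_iff (s : SOpen i j R₁ R₂) (v : Ix i j → Quad (ZMod p) Δ) :
    v ∈ LinearMap.range (combine (red p Δ (s.mu₁ Δ)).toRows₁ (red p Δ (s.mu₂ Δ)).toRows₁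
        (red p Δ (s.mu₁ Δ)).toRows₂) ↔
      ∃ u : Ix2 i j → Quad (ZMod p) Δ, (∀ x, (∀ b, x ≠ .inl (.inr b)) → (u x).im = 0) ∧
        u ᵥ* toQuad Δ ((s.primitive p).map (Int.cast : ℤ → ZMod p)) = v := by
  have hmul (u : Ix2 i j → Quad (ZMod p) Δ) :
      u ᵥ* toQuad Δ ((s.primitive p).map (Int.cast : ℤ → ZMod p)) =
        -((fun a => u (.inl (.inl a))) ᵥ* (red p Δ (s.mu₁ Δ)).toRows₁ +
          (fun a => u (.inr (.inl a))) ᵥ* (red p Δ (s.mu₂ Δ)).toRows₁ +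
          (fun b => u (.inl (.inr b))) ᵥ* (red p Δ (s.mu₁ Δ)).toRows₂) := by
    rw [toQuad_primitive, vecMul_neg]
    congr 1
    funext y
    simp [vecMul, dotProduct, toRows₁, toRows₂, add_right_comm]
  constructor
  · rintro ⟨x, rfl⟩
    refine ⟨-Sum.elim (Sum.elim (algebraMap _ _ ∘ x.1) x.2.2)
      (Sum.elim (algebraMap _ _ ∘ x.2.1) 0), ?_, ?_⟩
    · rintro ((a | a) | (a | a)) h
      · simp
      · exact absurd rfl (h a)
      · simp
      · simp
    · rw [neg_vecMul, hmul, neg_neg]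
      rfl
  · rintro ⟨u, hu, rfl⟩
    refine ⟨-(fun a => (u (.inl (.inl a))).re, fun a => (u (.inr (.inl a))).re,
      fun b => u (.inl (.inr b))), ?_⟩
    rw [map_neg, hmul, combine_apply]
    have h₁ : (algebraMap (ZMod p) (Quad (ZMod p) Δ) ∘ fun a => (u (.inl (.inl a))).re) =
        fun a => u (.inl (.inl a)) := by
      ext a
      · simp
      · simpa using (hu (.inl (.inl a)) (by simp)).symm
    have h₂ : (algebraMap (ZMod p) (Quad (ZMod p) Δ) ∘ fun a => (u (.inr (.inl a))).re) =
        fun a => u (.inr (.inl a)) := by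
      ext a
      · simp
      · simpa using (hu (.inr (.inl a)) (by simp)).symm
    rw [h₁, h₂]

variable [Fact p.Prime] {N : ℕ}

theorem DEquiv.invariant_le {s₁ s₂ : SOpen i j R₁ R₂} (h : DEquiv p Δ N s₁ s₂) :
    s₁.invariant p Δ ≤ s₂.invariant p Δ := by
  obtain ⟨Θ, m, heq, hΘ⟩ := h.exists_zmod
  have hZ : toQuad Δ ((s₁.primitive p).map (Int.cast : ℤ → ZMod p)) =
      Θ.map (algebraMap _ (Quad (ZMod p) Δ)) *
        toQuad Δ ((s₂.primitive p).map (Int.cast : ℤ → ZMod p)) * m.map star := by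
    rw [heq, toQuad_mul_alphaMap, toQuad_mul]
  let f : (Ix i j → Quad (ZMod p) Δ) →ₗ[ZMod p] (Ix i j → Quad (ZMod p) Δ) :=
    (vecMulLinear (m.map star)).restrictScalars (ZMod p)
  have hle : LinearMap.range (combine (red p Δ (s₁.mu₁ Δ)).toRows₁ (red p Δ (s₁.mu₂ Δ)).toRows₁
      (red p Δ (s₁.mu₁ Δ)).toRows₂) ≤ (LinearMap.range (combine (red p Δ (s₂.mu₁ Δ)).toRows₁
        (red p Δ (s₂.mu₂ Δ)).toRows₁ (red p Δ (s₂.mu₁ Δ)).toRows₂)).map f := by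
    intro v hv
    obtain ⟨u, hu, rfl⟩ := (mem_range_combine_iff s₁ v).1 hv
    refine ⟨_, (mem_range_combine_iff s₂ _).2
      ⟨u ᵥ* Θ.map (algebraMap _ (Quad (ZMod p) Δ)), fun x hx => ?_, rfl⟩, ?_⟩
    · simp only [vecMul, dotProduct, im_sum]
      refine Finset.sum_eq_zero fun y _ => ?_
      by_cases hy : ∃ b, y = .inl (.inr b)
      · obtain ⟨b, rfl⟩ := hy
        simp [hΘ b x hx]
      · simp [hu y (by simpa using hy)]
    · rw [hZ, ← vecMul_vecMul, ← vecMul_vecMul]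
      rfl
  exact (Submodule.finrank_mono hle).trans (Submodule.finrank_map_le _ _)

theorem DEquiv.invariant_eq {s₁ s₂ : SOpen i j R₁ R₂} (h : DEquiv p Δ N s₁ s₂) :
    s₁.invariant p Δ = s₂.invariant p Δ :=
  le_antisymm h.invariant_le
    (DEquiv.invariant_le ((dSetoid p Δ N i j R₁ R₂).symm h : DEquiv p Δ N s₂ s₁))

theorem invariant_of_mem_frakD (hfield : ∀ t : ZMod p, t ^ 2 ≠ -(Δ : ZMod p) + 0 * t) {k : ℕ}
    {s : SOpen i j R₁ R₂} (hs : s ∈ frakD p Δ i j R₁ R₂ k) :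
    s.invariant p Δ = i + 2 * j + k := by
  have : Fact (∀ t : ZMod p, t ^ 2 ≠ -(Δ : ZMod p) + 0 * t) := ⟨hfield⟩
  rcases hs with ⟨hdet, h⟩ | ⟨-, hdet, h⟩
  · exact mixedRank_of_eq (isUnit_iff_ne_zero.2 hdet) h
  · rw [invariant, mixedRank_comm, ← red_mu₂_toRows₂]
    exact mixedRank_of_eq (isUnit_iff_ne_zero.2 hdet) h

theorem invariant_of_mem_frakDStar (hfield : ∀ t : ZMod p, t ^ 2 ≠ -(Δ : ZMod p) + 0 * t)
    {s : SOpen 1 j R₁ R₂} (hs : s ∈ frakDStar p Δ 1 j R₁ R₂) : s.invariant p Δ ≤ 2 * j :=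
  mixedRank_le_of_det_eq_zero hfield s.red_mu₂_toRows₂ hs.1 hs.2

theorem exists_imRank {M M' : Matrix (Ix i j) (Ix i j) (Quad (ZMod p) Δ)} (hM : IsUnit M.det)
    (h : M'.toRows₂ = M.toRows₂) : ∃ k ≤ i, ImRank p Δ M M' k := by
  let X := M' * M⁻¹
  refine ⟨_, (rank_le_card_height _).trans_eq (Fintype.card_fin i), X.toBlocks₁₁, X.toBlocks₁₂,
    ?_, rfl⟩
  have hX : X.toRows₂ = fromCols 0 1 := by
    have h₁ : X.toRows₂ = M.toRows₂ * M⁻¹ := by rw [← h]; rfl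
    have h₂ : M.toRows₂ * M⁻¹ = (M * M⁻¹).toRows₂ := rfl
    rw [h₁, h₂, mul_nonsing_inv M hM]
    refine Matrix.ext fun a b => ?_
    rcases b with b | b <;> simp [toRows₂, Matrix.one_apply]
  have h₁ : X.toBlocks₂₁ = 0 := congrArg toCols₁ hX
  have h₂ : X.toBlocks₂₂ = 1 := congrArg toCols₂ hX
  rw [← h₁, ← h₂, fromBlocks_toBlocks]
  exact (nonsing_inv_mul_cancel_right M M' hM).symm

/-- The parts of the `𝔇`-partition cover. -/
theorem exists_mem_frakDPartition (hfield : ∀ t : ZMod p, t ^ 2 ≠ -(Δ : ZMod p) + 0 * t)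
    (s : SOpen i j R₁ R₂) : ∃ Q ∈ frakDPartition p Δ i j R₁ R₂, s ∈ Q := by
  have : Fact (∀ t : ZMod p, t ^ 2 ≠ -(Δ : ZMod p) + 0 * t) := ⟨hfield⟩
  by_cases h₁ : (red p Δ (s.mu₁ Δ)).det = 0
  · by_cases h₂ : (red p Δ (s.mu₂ Δ)).det = 0
    · exact ⟨_, .inl rfl, h₁, h₂⟩
    · obtain ⟨k, hk, h⟩ := exists_imRank (isUnit_iff_ne_zero.2 h₂) s.red_mu₂_toRows₂.symm
      exact ⟨_, .inr ⟨k, hk, rfl⟩, .inr ⟨h₁, h₂, h⟩⟩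
  · obtain ⟨k, hk, h⟩ := exists_imRank (isUnit_iff_ne_zero.2 h₁) s.red_mu₂_toRows₂
    exact ⟨_, .inr ⟨k, hk, rfl⟩, .inl ⟨h₁, h⟩⟩

/-- For `i = 1` the parts of the `𝔇`-partition are told apart by the value of `invariant`. -/
theorem eq_of_invariant_eq (hfield : ∀ t : ZMod p, t ^ 2 ≠ -(Δ : ZMod p) + 0 * t)
    {Q : Set (SOpen 1 j R₁ R₂)} (hQ : Q ∈ frakDPartition p Δ 1 j R₁ R₂)
    {s t : SOpen 1 j R₁ R₂} (hs : s ∈ Q) (h : s.invariant p Δ = t.invariant p Δ)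
    {Q' : Set (SOpen 1 j R₁ R₂)} (hQ' : Q' ∈ frakDPartition p Δ 1 j R₁ R₂) (ht : t ∈ Q') :
    Q = Q' := by
  rcases hQ with rfl | ⟨k, -, rfl⟩ <;> rcases hQ' with rfl | ⟨l, -, rfl⟩
  · rfl
  · have := invariant_of_mem_frakDStar hfield hs
    have := invariant_of_mem_frakD hfield ht
    omega
  · have := invariant_of_mem_frakD hfield hs
    have := invariant_of_mem_frakDStar hfield ht
    omega
  · have := invariant_of_mem_frakD hfield hs
    have := invariant_of_mem_frakD hfield ht
    rw [show k = l by omega]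

end SOpen

theorem sq_ne_of_legendreSym {p : ℕ} [Fact p.Prime] {Δ : ℕ}
    (hinert : legendreSym p (-(Δ : ℤ)) = -1) (t : ZMod p) :
    t ^ 2 ≠ -(Δ : ZMod p) + 0 * t := by
  intro h
  refine (legendreSym.eq_neg_one_iff p).1 hinert ⟨t, ?_⟩
  rw [← pow_two, h]
  simp

end HeckeUnitary

theorem mainTheorem5 (p : ℕ) [Fact p.Prime] (hp2 : p ≠ 2) (Δ : ℕ) (hΔ : 0 < Δ)
    (hinert : legendreSym p (-(Δ : ℤ)) = -1) (N : ℕ) (hN : 0 < N) (hpN : ¬ p ∣ N)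
    (R₁ R₂ : Set ℤ) (hR₁ : HeckeUnitary.IsResidueSystem p R₁)
    (hR₂ : HeckeUnitary.IsResidueSystem (p ^ 2) R₂) :
    (∀ σ₁ σ₂ : HeckeUnitary.SOpen 1 2 R₁ R₂,
      σ₁ ∈ HeckeUnitary.SOpen.frakD p Δ 1 2 R₁ R₂ 0 →
      σ₂ ∈ HeckeUnitary.SOpen.frakD p Δ 1 2 R₁ R₂ 1 →
      ¬ HeckeUnitary.SOpen.DEquiv p Δ N σ₁ σ₂) ∧
    (∀ σ₁ σ₂ : HeckeUnitary.SOpen 2 1 R₁ R₂,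
      σ₁ ∈ HeckeUnitary.SOpen.frakD p Δ 2 1 R₁ R₂ 1 →
      σ₂ ∈ HeckeUnitary.SOpen.frakD p Δ 2 1 R₁ R₂ 2 →
      ¬ HeckeUnitary.SOpen.DEquiv p Δ N σ₁ σ₂) ∧
    (∀ σ₁ σ₂ : HeckeUnitary.SOpen 1 2 R₁ R₂,
      σ₁ ∈ HeckeUnitary.SOpen.frakD p Δ 1 2 R₁ R₂ 0 ∪ HeckeUnitary.SOpen.frakD p Δ 1 2 R₁ R₂ 1 →
      σ₂ ∈ HeckeUnitary.SOpen.frakDStar p Δ 1 2 R₁ R₂ →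
      ¬ HeckeUnitary.SOpen.DEquiv p Δ N σ₁ σ₂) ∧
    (∀ P ∈ HeckeUnitary.SOpen.dPartition p Δ N 1 2 R₁ R₂,
      ∃! Q, Q ∈ HeckeUnitary.SOpen.frakDPartition p Δ 1 2 R₁ R₂ ∧ P ⊆ Q) := by
  have hfield := HeckeUnitary.sq_ne_of_legendreSym hinert
  refine ⟨fun σ₁ σ₂ h₁ h₂ h => ?_, fun σ₁ σ₂ h₁ h₂ h => ?_, fun σ₁ σ₂ h₁ h₂ h => ?_,
    fun P hP => ?_⟩
  · have := h.invariant_eq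
    rw [HeckeUnitary.SOpen.invariant_of_mem_frakD hfield h₁,
      HeckeUnitary.SOpen.invariant_of_mem_frakD hfield h₂] at this
    omega
  · have := h.invariant_eq
    rw [HeckeUnitary.SOpen.invariant_of_mem_frakD hfield h₁,
      HeckeUnitary.SOpen.invariant_of_mem_frakD hfield h₂] at this
    omega
  · have h₂ := HeckeUnitary.SOpen.invariant_of_mem_frakDStar hfield h₂
    rw [← h.invariant_eq] at h₂
    rcases h₁ with h₁ | h₁ <;>
      rw [HeckeUnitary.SOpen.invariant_of_mem_frakD hfield h₁] at h₂ <;> omega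
  · obtain ⟨s, rfl⟩ := hP
    obtain ⟨Q, hQ, hs⟩ := HeckeUnitary.SOpen.exists_mem_frakDPartition hfield s
    refine ⟨Q, ⟨hQ, fun t ht => ?_⟩, fun Q' hQ' => ?_⟩
    · have hts : HeckeUnitary.SOpen.DEquiv p Δ N t s := ht
      obtain ⟨Q', hQ', ht'⟩ := HeckeUnitary.SOpen.exists_mem_frakDPartition hfield t
      rwa [HeckeUnitary.SOpen.eq_of_invariant_eq hfield hQ hs hts.invariant_eq.symm hQ' ht']
    · exact HeckeUnitary.SOpen.eq_of_invariant_eq hfield hQ'.1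
        (hQ'.2 ((HeckeUnitary.SOpen.dSetoid p Δ N 1 2 R₁ R₂).refl s)) rfl hQ hs
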